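/- Let $\Omega\subset\mathbb{R}$ be a nonempty connected open set (an open interval), and let $F$ be a complex-valued function that is continuous on $\Omega-\Omega=\{x-y: x,y\in\Omega\}$ and positive definite there, i.e. $\sum_{i}\sum_{j}\overline{c_i}\,c_j\,F(x_i-x_j)\ge 0$ for all finite families $c_i\in\mathbb{C}$, $x_i\in\Omega$. Let $\mathscr{H}_F$ be the reproducing kernel Hilbert space of functions on $\Omega$ with kernel $(x,y)\mapsto F(x-y)$, i.e. the completion of the span of the functions $F(\cdot-x)$, $x\in\Omega$, in the inner product (conjugate linear in the first variable) determined by $\langle F(\cdot-x),F(\cdot-y)\rangle_{\mathscr{H}_F}=F(x-y)$. For $\varphi\in C_c^\infty(\Omega)$ (complex-valued) let $F_\varphi\in\mathscr{H}_F$ be given by $F_\varphi(x)=\int_\Omega\varphi(y)F(x-y)\,dy$, $x\in\Omega$. Then the following two conditions are equivalent. (i) There is a continuous positive definite function $\widetilde F:\mathbb{R}\to\mathbb{C}$ with $\widetilde F(x)=F(x)$ for all $x\in\Omega-\Omega$. (ii) There are a complex Hilbert space $\mathscr{K}$, a linear isometry $W:\mathscr{H}_F\to\mathscr{K}$, and a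 strongly continuous one-parameter unitary group $(U_t)_{t\in\mathbb{R}}$ on $\mathscr{K}$ such that, if $A$ denotes its (skew-adjoint) infinitesimal generator, i.e. $Ak=\lim_{t\to0}\tfrac1t(U_tk-k)$ with $\mathrm{dom}(A)$ the set of all $k\in\mathscr{K}$ for which this limit exists, then $$WF_\varphi\in\mathrm{dom}(A)\quad\text{and}\quad AWF_\varphi=WF_{\varphi'}\qquad\text{for all }\varphi\in C_c^\infty(\Omega).$$ -/

import Mathlib

open Filter Topology MeasureTheory TopologicalSpace
open scoped ComplexConjugate ComplexOrder Pointwise Distributions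

universe u

noncomputable section

namespace PDExt

/-- `F` is positive definite on `Ω - Ω`: all finite sums `∑ᵢ ∑ⱼ conj cᵢ * cⱼ * F (xᵢ - xⱼ)` with
`xᵢ ∈ Ω` are real and nonnegative. Only the values of `F` on `Ω - Ω` matter; for `Ω = univ` this is
positive definiteness on `ℝ`. -/
def IsPositiveDefiniteOn (F : ℝ → ℂ) (Ω : Set ℝ) : Prop :=
  ∀ (n : ℕ) (c : Fin n → ℂ) (x : Fin n → ℝ), (∀ i, x i ∈ Ω) →
    0 ≤ ∑ i, ∑ j, conj (c i) * c j * F (x i - x j)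

/-- The kernel `(x, y) ↦ F (x - y)` on `Ω × Ω`; scalars are regarded as operators on `ℂ`. -/
def kernelMatrix (F : ℝ → ℂ) (Ω : Opens ℝ) : Matrix Ω Ω (ℂ →L[ℂ] ℂ) :=
  Matrix.of fun x y => F ((x : ℝ) - y) • ContinuousLinearMap.id ℂ ℂ

variable {F : ℝ → ℂ} {Ω : Opens ℝ}

theorem kernelMatrix_apply (x y : Ω) (z : ℂ) : kernelMatrix F Ω x y z = F ((x : ℝ) - y) * z := by
  simp [kernelMatrix]

theorem IsPositiveDefiniteOn.conj_apply {S : Set ℝ} (hF : IsPositiveDefiniteOn F S) {x y : ℝ}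
    (hx : x ∈ S) (hy : y ∈ S) : conj (F (y - x)) = F (x - y) := by
  have h1 := (Complex.nonneg_iff.1 (hF 1 ![1] ![x] (by simp [hx]))).2
  have h2 := (Complex.nonneg_iff.1 (hF 2 ![1, 1] ![x, y]
    (by intro i; fin_cases i <;> simp [hx, hy]))).2
  have h3 := (Complex.nonneg_iff.1 (hF 2 ![1, Complex.I] ![x, y]
    (by intro i; fin_cases i <;> simp [hx, hy]))).2
  simp [Fin.sum_univ_two] at h1 h2 h3
  apply Complex.ext <;> simp <;> linarith

theorem IsPositiveDefiniteOn.posSemidef (hF : IsPositiveDefiniteOn F Ω) :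
    (kernelMatrix F Ω).PosSemidef := by
  have tfae := (RKHS.posSemidef_tfae (K := kernelMatrix F Ω)).out 0 2
  refine tfae.2 ⟨?_, fun v => ?_⟩
  · ext x y
    refine ext_inner_right ℂ fun w => ?_
    simp only [Matrix.conjTranspose_apply, ContinuousLinearMap.star_eq_adjoint,
      ContinuousLinearMap.adjoint_inner_left, kernelMatrix_apply]
    simp only [RCLike.inner_apply, map_mul, map_one, hF.conj_apply y.2 x.2]
    ring
  · let e := v.support.equivFin
    have h := hF v.support.card (fun i => v (e.symm i)) (fun i => ((e.symm i : Ω) : ℝ))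
      (fun i => (e.symm i : Ω).2)
    have key : (v.sum fun x w => v.sum fun x' w' => inner ℂ (kernelMatrix F Ω x' x w) w') =
        ∑ i, ∑ j, conj (v (e.symm i)) * v (e.symm j) *
          F (((e.symm i : Ω) : ℝ) - ((e.symm j : Ω) : ℝ)) := by
      simp only [Finsupp.sum]
      rw [← Finset.sum_coe_sort v.support, ← e.symm.sum_comp]
      refine Finset.sum_congr rfl fun i _ => ?_
      rw [← Finset.sum_coe_sort v.support, ← e.symm.sum_comp]
      refine Finset.sum_congr rfl fun j _ => ?_
      rw [kernelMatrix_apply, RCLike.inner_apply, map_mul,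
        hF.conj_apply (e.symm i : Ω).2 (e.symm j : Ω).2]
      ring
    rw [key]
    exact (Complex.nonneg_iff.1 h).1

/-- The reproducing kernel Hilbert space `ℋ_F` of the kernel `(x, y) ↦ F (x - y)` on `Ω × Ω`. -/
def HF (hF : IsPositiveDefiniteOn F Ω) : Type :=
  haveI : Fact (kernelMatrix F Ω).PosSemidef := ⟨hF.posSemidef⟩
  RKHS.OfKernel (kernelMatrix F Ω)

instance (hF : IsPositiveDefiniteOn F Ω) : NormedAddCommGroup (HF hF) :=
  haveI : Fact (kernelMatrix F Ω).PosSemidef := ⟨hF.posSemidef⟩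
  inferInstanceAs (NormedAddCommGroup (RKHS.OfKernel (kernelMatrix F Ω)))

instance (hF : IsPositiveDefiniteOn F Ω) : InnerProductSpace ℂ (HF hF) :=
  haveI : Fact (kernelMatrix F Ω).PosSemidef := ⟨hF.posSemidef⟩
  inferInstanceAs (InnerProductSpace ℂ (RKHS.OfKernel (kernelMatrix F Ω)))

instance (hF : IsPositiveDefiniteOn F Ω) : CompleteSpace (HF hF) :=
  haveI : Fact (kernelMatrix F Ω).PosSemidef := ⟨hF.posSemidef⟩
  inferInstanceAs (CompleteSpace (RKHS.OfKernel (kernelMatrix F Ω)))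

instance (hF : IsPositiveDefiniteOn F Ω) : RKHS ℂ (HF hF) Ω ℂ :=
  haveI : Fact (kernelMatrix F Ω).PosSemidef := ⟨hF.posSemidef⟩
  inferInstanceAs (RKHS ℂ (RKHS.OfKernel (kernelMatrix F Ω)) Ω ℂ)

theorem kernel_HF (hF : IsPositiveDefiniteOn F Ω) : RKHS.kernel (HF hF) = kernelMatrix F Ω :=
  haveI : Fact (kernelMatrix F Ω).PosSemidef := ⟨hF.posSemidef⟩
  RKHS.OfKernel.kernel_ofKernel (K := kernelMatrix F Ω)

/-- The kernel function `F (· - y) ∈ ℋ_F`. -/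
def xi (hF : IsPositiveDefiniteOn F Ω) (y : Ω) : HF hF := RKHS.kerFun (HF hF) y (1 : ℂ)

theorem xi_apply (hF : IsPositiveDefiniteOn F Ω) (x y : Ω) : xi hF y x = F ((x : ℝ) - y) := by
  rw [xi, RKHS.kerFun_apply, kernel_HF, kernelMatrix_apply, mul_one]

theorem inner_xi (hF : IsPositiveDefiniteOn F Ω) (x : Ω) (f : HF hF) :
    inner ℂ (xi hF x) f = f x := by
  rw [xi, RKHS.kerFun_inner]; simp

theorem inner_xi_xi (hF : IsPositiveDefiniteOn F Ω) (x y : Ω) :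
    inner ℂ (xi hF x) (xi hF y) = F ((x : ℝ) - y) := by
  rw [inner_xi, xi_apply]

/-- The vector `F_φ = ∫_Ω φ(y) F(· - y) dy` of `ℋ_F`, as a Bochner integral in `ℋ_F`; see
`Fphi_apply` for its values as a function on `Ω`. -/
def Fphi (hF : IsPositiveDefiniteOn F Ω) (φ : ℝ → ℂ) : HF hF :=
  ∫ y : Ω, φ y • xi hF y ∂(volume.comap Subtype.val)

theorem continuous_xi (hF : IsPositiveDefiniteOn F Ω)
    (hc : ContinuousOn F ((Ω : Set ℝ) - (Ω : Set ℝ))) : Continuous (xi hF) := by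
  have hmem (x y : Ω) : (x : ℝ) - y ∈ (Ω : Set ℝ) - (Ω : Set ℝ) := Set.sub_mem_sub x.2 y.2
  have hG : Continuous fun p : Ω × Ω => F ((p.1 : ℝ) - p.2) :=
    hc.comp_continuous (by fun_prop) fun p => hmem p.1 p.2
  have hn (x y : Ω) : ‖xi hF x - xi hF y‖ ^ 2 =
      (F ((x : ℝ) - x) - F ((x : ℝ) - y) - F ((y : ℝ) - x) + F ((y : ℝ) - y)).re := by
    rw [← inner_self_eq_norm_sq (𝕜 := ℂ)]
    simp only [inner_sub_left, inner_sub_right, inner_xi_xi]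
    simp
    ring
  rw [continuous_iff_continuousAt]
  intro y
  rw [ContinuousAt, tendsto_iff_norm_sub_tendsto_zero]
  have h2 : Tendsto (fun x => ‖xi hF x - xi hF y‖ ^ 2) (𝓝 y) (𝓝 0) := by
    simp only [hn]
    have : Continuous fun x : Ω =>
        (F ((x : ℝ) - x) - F ((x : ℝ) - y) - F ((y : ℝ) - x) + F ((y : ℝ) - y)).re :=
      Complex.continuous_re.comp ((((hG.comp (continuous_id.prodMk continuous_id)).sub
        (hG.comp (continuous_id.prodMk continuous_const))).sub
        (hG.comp (continuous_const.prodMk continuous_id))).add continuous_const)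
    have h := this.tendsto y
    simpa using h
  have h3 := h2.sqrt
  simpa using h3

theorem integrable_Fphi (hF : IsPositiveDefiniteOn F Ω)
    (hc : ContinuousOn F ((Ω : Set ℝ) - (Ω : Set ℝ))) {φ : ℝ → ℂ} (hφ : Continuous φ)
    (hφc : HasCompactSupport φ) :
    Integrable (fun y : Ω => φ y • xi hF y) (volume.comap Subtype.val) := by
  have h1 : Integrable (fun y : Ω => φ y) (volume.comap Subtype.val) :=
    (integrableOn_iff_comap_subtypeVal Ω.isOpen.measurableSet).1
      (hφ.integrable_of_hasCompactSupport hφc).integrableOn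
  refine h1.smul_bdd (Real.sqrt ‖F 0‖) (continuous_xi hF hc).aestronglyMeasurable
    (.of_forall fun y => ?_)
  apply Real.le_sqrt_of_sq_le
  rw [← inner_self_eq_norm_sq (𝕜 := ℂ), inner_xi_xi, sub_self]
  exact Complex.re_le_norm _

/-- As a function on `Ω`, `F_φ` is the convolution `x ↦ ∫_Ω φ(y) F(x - y) dy`. -/
theorem Fphi_apply (hF : IsPositiveDefiniteOn F Ω)
    (hc : ContinuousOn F ((Ω : Set ℝ) - (Ω : Set ℝ))) {φ : ℝ → ℂ} (hφ : Continuous φ)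
    (hφc : HasCompactSupport φ) (x : Ω) :
    Fphi hF φ x = ∫ y in (Ω : Set ℝ), φ y * F (x - y) := by
  rw [← inner_xi, Fphi, ← integral_inner (integrable_Fphi hF hc hφ hφc)]
  simp only [inner_smul_right, inner_xi_xi]
  exact integral_subtype_comap Ω.isOpen.measurableSet fun y => φ y * F (x - y)

/-- A strongly continuous one-parameter unitary group on `𝒦`. -/
structure UnitaryGroup (𝒦 : Type*) [NormedAddCommGroup 𝒦] [InnerProductSpace ℂ 𝒦] where
  /-- The unitary operator `U_t`. -/
  U : ℝ → (𝒦 ≃ₗᵢ[ℂ] 𝒦)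
  zero : ∀ k, U 0 k = k
  add : ∀ s t k, U (s + t) k = U s (U t k)
  continuous : ∀ k, Continuous fun t => U t k

namespace UnitaryGroup

variable {𝒦 : Type*} [NormedAddCommGroup 𝒦] [InnerProductSpace ℂ 𝒦]

/-- `(U_t k - k) / t → l` as `t → 0`. -/
def HasGeneratorAt (U : UnitaryGroup 𝒦) (k l : 𝒦) : Prop :=
  Tendsto (fun t : ℝ => ((t⁻¹ : ℝ) : ℂ) • (U.U t k - k)) (𝓝[≠] 0) (𝓝 l)

theorem HasGeneratorAt.add {U : UnitaryGroup 𝒦} {k l k' l' : 𝒦} (h : U.HasGeneratorAt k l)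
    (h' : U.HasGeneratorAt k' l') : U.HasGeneratorAt (k + k') (l + l') := by
  refine (Tendsto.add h h').congr fun t => ?_
  rw [map_add, ← smul_add]
  congr 1
  abel

theorem HasGeneratorAt.smul {U : UnitaryGroup 𝒦} {k l : 𝒦} (h : U.HasGeneratorAt k l) (c : ℂ) :
    U.HasGeneratorAt (c • k) (c • l) := by
  refine (Tendsto.const_smul h c).congr fun t => ?_
  rw [map_smul, ← smul_sub, smul_comm]

theorem HasGeneratorAt.unique {U : UnitaryGroup 𝒦} {k l l' : 𝒦} (h : U.HasGeneratorAt k l)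
    (h' : U.HasGeneratorAt k l') : l = l' :=
  tendsto_nhds_unique h h'

/-- The infinitesimal generator `A` of `U`: its domain is the set of all `k` for which
`(U_t k - k) / t` converges in `𝒦` as `t → 0`, and `A k` is the limit. -/
def generator (U : UnitaryGroup 𝒦) : 𝒦 →ₗ.[ℂ] 𝒦 where
  domain :=
    { carrier := {k | ∃ l, U.HasGeneratorAt k l}
      add_mem' := by
        rintro _ _ ⟨l, h⟩ ⟨l', h'⟩
        exact ⟨_, h.add h'⟩
      zero_mem' := ⟨0, by simp [HasGeneratorAt]⟩
      smul_mem' := by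
        rintro c _ ⟨l, h⟩
        exact ⟨_, h.smul c⟩ }
  toFun :=
    { toFun := fun k => Classical.choose k.2
      map_add' := fun k k' => (Classical.choose_spec (k + k').2).unique
        ((Classical.choose_spec k.2).add (Classical.choose_spec k'.2))
      map_smul' := fun c k => (Classical.choose_spec (c • k).2).unique
        ((Classical.choose_spec k.2).smul c) }

theorem tendsto_generator (U : UnitaryGroup 𝒦) (k : U.generator.domain) :
    Tendsto (fun t : ℝ => ((t⁻¹ : ℝ) : ℂ) • (U.U t k - (k : 𝒦))) (𝓝[≠] 0)
      (𝓝 (U.generator k)) :=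
  Classical.choose_spec k.2

end UnitaryGroup

end PDExt

end

/-!
Both conditions say that, up to an isometry `W`, the kernel functions `ξ_x = F (· - x)` lie on a
single orbit of a unitary group: `W ξ_x = U_{-x} κ` for all `x ∈ Ω`.

Given such an orbit, `t ↦ ⟪κ, U_t κ⟫` is a positive definite extension of `F`. Conversely an
extension `F'` makes translation of its own kernel functions unitary, which gives `U` and `κ` with
`⟪κ, U_t κ⟫ = F' t`, and `W` exists because `U_{-x} κ` and `ξ_x` have the same Gram kernel on `Ω`.

On an orbit, `W F_φ = ∫ φ(y) U_{-y} κ dy` is a Gårding vector: `U_t W F_φ = ∫ φ(t - y) U_y κ dy`, so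
differentiating in `t` differentiates `φ`. Conversely, if the generator maps `W F_φ` to `W F_{φ'}`,
then for a mollifier `φ` of small support the function `s ↦ U_s ∫ φ(s - y) W ξ_y dy` has derivative
zero, because the generator contributes `-∫ φ'(s - y) W ξ_y dy` and cancels the derivative of the
integrand; letting `φ` shrink to a point mass shows that `U_x W ξ_x` does not depend on `x ∈ Ω`.
-/

noncomputable section

namespace PDExt

section Gram

variable {𝕜 ι E G : Type*} [RCLike 𝕜] [NormedAddCommGroup E] [InnerProductSpace 𝕜 E]
  [NormedAddCommGroup G] [InnerProductSpace 𝕜 G] {f : ι → E} {g : ι → G}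

theorem norm_linearCombination_eq_of_inner_eq
    (h : ∀ i j, inner 𝕜 (g i) (g j) = inner 𝕜 (f i) (f j)) (a : ι →₀ 𝕜) :
    ‖Finsupp.linearCombination 𝕜 g a‖ = ‖Finsupp.linearCombination 𝕜 f a‖ := by
  simp only [norm_eq_sqrt_re_inner (𝕜 := 𝕜), Finsupp.linearCombination_apply, Finsupp.sum_inner,
    Finsupp.inner_sum, inner_smul_left, inner_smul_right, h]

theorem exists_linearIsometry_of_inner_eq [CompleteSpace G]
    (hf : Dense (Submodule.span 𝕜 (Set.range f) : Set E))
    (h : ∀ i j, inner 𝕜 (g i) (g j) = inner 𝕜 (f i) (f j)) :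
    ∃ T : E →ₗᵢ[𝕜] G, ∀ i, T (f i) = g i := by
  have hf' : DenseRange (Finsupp.linearCombination 𝕜 f) := by
    rwa [DenseRange, ← LinearMap.coe_range, Finsupp.range_linearCombination]
  have hnorm := norm_linearCombination_eq_of_inner_eq h
  let T := (Finsupp.linearCombination 𝕜 g).extendOfNorm (Finsupp.linearCombination 𝕜 f)
  have hT : ∀ a, T (Finsupp.linearCombination 𝕜 f a) = Finsupp.linearCombination 𝕜 g a :=
    LinearMap.extendOfNorm_eq hf' ⟨1, fun a => by rw [hnorm, one_mul]⟩
  refine ⟨⟨T.toLinearMap, fun x => ?_⟩, fun i => ?_⟩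
  · refine hf'.induction_on x (isClosed_eq (by fun_prop) (by fun_prop)) fun a => ?_
    exact (congrArg norm (hT a)).trans (hnorm a)
  · simpa using hT (Finsupp.single i 1)

theorem linearIsometry_apply_eq_of_dense_span {S T : E →ₗᵢ[𝕜] G}
    (hf : Dense (Submodule.span 𝕜 (Set.range f) : Set E)) (h : ∀ i, S (f i) = T (f i)) (x : E) :
    S x = T x :=
  DFunLike.congr_fun (ContinuousLinearMap.ext_on (f := S.toContinuousLinearMap)
    (g := T.toContinuousLinearMap) hf (Set.forall_mem_range.2 h)) x

theorem continuous_linearIsometry_apply_of_dense_span {X : Type*} [TopologicalSpace X]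
    {T : X → E →ₗᵢ[𝕜] G} (hf : Dense (Submodule.span 𝕜 (Set.range f) : Set E))
    (hT : ∀ i, Continuous fun t => T t (f i)) (k : E) : Continuous fun t => T t k := by
  refine continuous_of_uniform_approx_of_continuous fun u hu => ?_
  obtain ⟨ε, hε, hεu⟩ := Metric.mem_uniformity_dist.1 hu
  obtain ⟨k', hk', hdist⟩ := hf.exists_dist_lt k hε
  refine ⟨fun t => T t k', ?_, fun t => hεu ((T t).isometry.dist_eq k k' ▸ hdist)⟩
  refine Submodule.span_induction (p := fun v _ => Continuous fun t => T t v)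
    (Set.forall_mem_range.2 hT) ?_ ?_ ?_ hk'
  · simpa only [map_zero] using continuous_const
  · exact fun v w _ _ hv hw => (hv.add hw).congr fun t => (map_add (T t) v w).symm
  · exact fun c v _ hv => (hv.const_smul c).congr fun t => (map_smul (T t) c v).symm

end Gram

theorem isPositiveDefiniteOn_of_inner_eq {E : Type*} [NormedAddCommGroup E]
    [InnerProductSpace ℂ E] {F : ℝ → ℂ} {S : Set ℝ} {ξ : ℝ → E}
    (h : ∀ x ∈ S, ∀ y ∈ S, inner ℂ (ξ x) (ξ y) = F (x - y)) : IsPositiveDefiniteOn F S := by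
  intro n c x hx
  have hgram : ∑ i, ∑ j, conj (c i) * c j * F (x i - x j) =
      inner ℂ (∑ i, c i • ξ (x i)) (∑ i, c i • ξ (x i)) := by
    rw [sum_inner]
    simp only [inner_sum, inner_smul_left, inner_smul_right, h _ (hx _) _ (hx _), mul_assoc,
      mul_left_comm]
  rw [hgram, inner_self_eq_norm_sq_to_K]
  positivity

namespace UnitaryGroup

variable {E : Type*} [NormedAddCommGroup E] [InnerProductSpace ℂ E] (U : UnitaryGroup E)

theorem continuous_uncurry : Continuous fun p : ℝ × E => U.U p.1 p.2 :=
  continuous_prod_of_continuous_lipschitzWith' _ 1 (fun t => (U.U t).lipschitz) U.continuous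

theorem inner_apply_neg_apply_neg (s t : ℝ) (k l : E) :
    inner ℂ (U.U (-s) k) (U.U (-t) l) = inner ℂ k (U.U (s - t) l) := by
  rw [← (U.U s).inner_map_map, ← U.add, ← U.add, add_neg_cancel, U.zero, sub_eq_add_neg]

theorem hasGeneratorAt_iff_hasDerivAt {k l : E} :
    U.HasGeneratorAt k l ↔ HasDerivAt (fun t => U.U t k) l 0 := by
  rw [hasDerivAt_iff_tendsto_slope_zero, HasGeneratorAt]
  simp only [zero_add, U.zero, Complex.coe_smul]

theorem exists_generator_apply_eq_iff {k l : E} :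
    (∃ h : k ∈ U.generator.domain, U.generator ⟨k, h⟩ = l) ↔ U.HasGeneratorAt k l := by
  refine ⟨?_, fun h => ⟨⟨l, h⟩, HasGeneratorAt.unique (U.tendsto_generator ⟨k, l, h⟩) h⟩⟩
  rintro ⟨h, rfl⟩
  exact U.tendsto_generator ⟨k, h⟩

theorem hasDerivAt_apply {g : ℝ → E} {g' l : E} {s : ℝ} (hg : HasDerivAt g g' s)
    (hl : U.HasGeneratorAt (g s) l) :
    HasDerivAt (fun t => U.U t (g t)) (U.U s (l + g')) s := by
  rw [hasDerivAt_iff_tendsto_slope_zero] at hg ⊢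
  have hs : Tendsto (fun t : ℝ => s + t) (𝓝[≠] 0) (𝓝 s) :=
    ((continuous_const_add s).tendsto' 0 s (add_zero s)).mono_left nhdsWithin_le_nhds
  have hquot := ((U.U s).continuous.tendsto l).comp hl
  have hmove := (U.continuous_uncurry.tendsto (s, g')).comp (hs.prodMk_nhds hg)
  rw [map_add]
  -- `(U_{s+t} g(s+t) - U_s g(s)) / t = U_s ((U_t - 1) g(s) / t) + U_{s+t} ((g(s+t) - g(s)) / t)`
  refine (hquot.add hmove).congr fun t => ?_
  simp only [Function.comp_apply, ← Complex.coe_smul, map_smul, map_sub, U.add, ← smul_add]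
  congr 1
  abel

/-- The conjugate `e ∘ U_t ∘ e⁻¹` of a unitary group by a unitary equivalence `e`. -/
def map {G : Type*} [NormedAddCommGroup G] [InnerProductSpace ℂ G] (e : E ≃ₗᵢ[ℂ] G) :
    UnitaryGroup G where
  U t := (e.symm.trans (U.U t)).trans e
  zero k := by simp [U.zero]
  add s t k := by simp [U.add]
  continuous k := e.continuous.comp (U.continuous _)

theorem map_apply {G : Type*} [NormedAddCommGroup G] [InnerProductSpace ℂ G] (e : E ≃ₗᵢ[ℂ] G)
    (t : ℝ) (k : E) : (U.map e).U t (e k) = e (U.U t k) := by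
  simp [map]

end UnitaryGroup

theorem exists_unitaryGroup_of_translation_invariant {E : Type*} [NormedAddCommGroup E]
    [InnerProductSpace ℂ E] [CompleteSpace E] {ξ : ℝ → E} (hξ : Continuous ξ)
    (hdense : Dense (Submodule.span ℂ (Set.range ξ) : Set E))
    (hinv : ∀ t x y, inner ℂ (ξ (x - t)) (ξ (y - t)) = inner ℂ (ξ x) (ξ y)) :
    ∃ U : UnitaryGroup E, ∀ t x, U.U t (ξ x) = ξ (x - t) := by
  choose T hT using fun t : ℝ => exists_linearIsometry_of_inner_eq hdense (hinv t)
  have hzero (k : E) : T 0 k = k :=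
    linearIsometry_apply_eq_of_dense_span (T := .id) hdense (fun x => by simp [hT]) k
  have hadd (s t : ℝ) (k : E) : T (s + t) k = T s (T t k) :=
    linearIsometry_apply_eq_of_dense_span (T := (T s).comp (T t)) hdense
      (fun x => by simp [hT, sub_sub, add_comm s t]) k
  have hsurj (t : ℝ) : Function.Surjective (T t) := fun k =>
    ⟨T (-t) k, by rw [← hadd, add_neg_cancel, hzero]⟩
  refine ⟨⟨fun t => .ofSurjective (T t) (hsurj t), hzero, hadd, ?_⟩, hT⟩
  exact continuous_linearIsometry_apply_of_dense_span hdense fun x => by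
    simp only [hT]
    fun_prop

section Convolution

theorem hasDerivAt_integral_smul_sub {𝕜 E : Type*} [RCLike 𝕜] [NormedAddCommGroup E]
    [NormedSpace ℝ E] [NormedSpace 𝕜 E] {k : ℝ → E} (hk : LocallyIntegrable k) {φ : ℝ → 𝕜}
    (hφ : ContDiff ℝ 1 φ) (hφc : HasCompactSupport φ) (s : ℝ) :
    HasDerivAt (fun s => ∫ y, φ (s - y) • k y) (∫ y, deriv φ (s - y) • k y) s :=
  hφc.hasDerivAt_convolution_right (ContinuousLinearMap.lsmul ℝ 𝕜 (E := E)).flip hk hφ s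

theorem tendsto_integral_normed_smul {E ι : Type*} [NormedAddCommGroup E] [NormedSpace ℝ E]
    [CompleteSpace E] {k : ℝ → E} (hk : AEStronglyMeasurable k) {x : ℝ} (hx : ContinuousAt k x)
    {l : Filter ι} {b : ι → ContDiffBump (0 : ℝ)} (hb : Tendsto (fun i => (b i).rOut) l (𝓝 0)) :
    Tendsto (fun i => ∫ y, (b i).normed volume (x - y) • k y) l (𝓝 (k x)) := by
  simpa only [convolution_lsmul_swap] using
    ContDiffBump.convolution_tendsto_right (μ := volume) (g := fun _ => k) (k := fun _ => x) hb
      (.of_forall fun _ => hk) (hx.tendsto.comp tendsto_snd) tendsto_const_nhds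

theorem exists_contDiffBump_rOut_le_tendsto {E : Type*} (c : E) {r : ℝ} (hr : 0 < r) :
    ∃ b : ℕ → ContDiffBump c,
      (∀ n, (b n).rOut ≤ r) ∧ Tendsto (fun n => (b n).rOut) atTop (𝓝 0) := by
  refine ⟨fun n => ⟨r / (n + 1) / 2, r / (n + 1), by positivity, half_lt_self (by positivity)⟩,
    fun n => div_le_self hr.le (by simp), ?_⟩
  simpa only [mul_one_div, mul_zero] using
    (tendsto_one_div_add_atTop_nhds_zero_nat (𝕜 := ℝ)).const_mul r

/-- The test function `y ↦ φ (s - y)` on `Ω`, whose integral against `k` is the convolution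
`(φ ⋆ k) s`. -/
def convolutionTestFunction {Ω : Opens ℝ} {φ : ℝ → ℂ} (hφ : ContDiff ℝ (⊤ : ℕ∞) φ)
    (hφc : HasCompactSupport φ) (s : ℝ) (hs : ∀ y ∈ tsupport φ, s - y ∈ Ω) : 𝓓(Ω, ℂ) where
  toFun y := φ (s - y)
  contDiff' := hφ.comp (contDiff_const.sub contDiff_id)
  hasCompactSupport' := hφc.comp_homeomorph (Homeomorph.subLeft s)
  tsupport_subset' y hy := by
    have hy' : s - y ∈ tsupport φ :=
      tsupport_comp_subset_preimage φ (Homeomorph.subLeft s).continuous hy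
    exact sub_sub_cancel s y ▸ hs _ hy'

end Convolution

theorem eq_of_convex_of_hasDerivAt_zero {𝕜 E : Type*} [RCLike 𝕜] [NormedAddCommGroup E]
    [NormedSpace 𝕜 E] {f : 𝕜 → E} {s : Set 𝕜} (hs : Convex ℝ s) (hf : ∀ x ∈ s, HasDerivAt f 0 x)
    {x y : 𝕜} (hx : x ∈ s) (hy : y ∈ s) : f x = f y := by
  have hle := hs.norm_image_sub_le_of_norm_hasDerivWithin_le (C := 0)
    (fun z hz => (hf z hz).hasDerivWithinAt) (by simp) hy hx
  rwa [zero_mul, norm_le_zero_iff, sub_eq_zero] at hle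

namespace UnitaryGroup

variable {E : Type*} [NormedAddCommGroup E] [InnerProductSpace ℂ E] (U : UnitaryGroup E)

theorem hasGeneratorAt_integral_smul_orbit {φ : ℝ → ℂ} (hφ : ContDiff ℝ 1 φ)
    (hφc : HasCompactSupport φ) (κ : E) :
    U.HasGeneratorAt (∫ y, φ y • U.U (-y) κ) (∫ y, deriv φ y • U.U (-y) κ) := by
  have hconv (ψ : ℝ → ℂ) (t : ℝ) :
      U.U t (∫ y, ψ y • U.U (-y) κ) = ∫ y, ψ (t - y) • U.U y κ := by
    rw [← integral_sub_left_eq_self _ volume t]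
    refine ((U.U t).toContinuousLinearEquiv.integral_comp_comm _).symm.trans ?_
    simp [← U.add]
  have hderiv := hasDerivAt_integral_smul_sub (U.continuous κ).locallyIntegrable hφ hφc 0
  simp only [← hconv, U.zero] at hderiv
  exact U.hasGeneratorAt_iff_hasDerivAt.2 hderiv

section Integrate

variable {Ω : Opens ℝ} {k : ℝ → E} (hk : LocallyIntegrable k)
  (hgen : ∀ φ : 𝓓(Ω, ℂ), U.HasGeneratorAt (∫ y, φ y • k y) (∫ y, deriv φ y • k y))

include hk hgen

theorem hasDerivAt_apply_integral_smul_sub {φ : ℝ → ℂ} (hφ : ContDiff ℝ (⊤ : ℕ∞) φ)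
    (hφc : HasCompactSupport φ) {s : ℝ} (hs : ∀ y ∈ tsupport φ, s - y ∈ Ω) :
    HasDerivAt (fun t => U.U t (∫ y, φ (t - y) • k y)) 0 s := by
  have hconv := hasDerivAt_integral_smul_sub hk (hφ.of_le (by simp)) hφc s
  have hcancel : U.HasGeneratorAt (∫ y, φ (s - y) • k y) (-∫ y, deriv φ (s - y) • k y) := by
    have hψ : U.HasGeneratorAt (∫ y, φ (s - y) • k y) (∫ y, deriv (fun y => φ (s - y)) y • k y) :=
      hgen (convolutionTestFunction hφ hφc s hs)
    simpa only [deriv_comp_const_sub, neg_smul, integral_neg] using hψ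
  simpa using U.hasDerivAt_apply hconv hcancel

theorem apply_eq_apply_of_hasGeneratorAt [CompleteSpace E] (hΩ : IsPreconnected (Ω : Set ℝ))
    (hkc : ContinuousOn k Ω) {x x' : ℝ} (hx : x ∈ Ω) (hx' : x' ∈ Ω) :
    U.U x (k x) = U.U x' (k x') := by
  obtain ⟨r, hr, hrΩ⟩ := isCompact_uIcc.exists_cthickening_subset_open Ω.isOpen
    (hΩ.ordConnected.uIcc_subset hx hx')
  obtain ⟨b, hbr, hb⟩ := exists_contDiffBump_rOut_le_tendsto (0 : ℝ) hr
  let φ (n : ℕ) (y : ℝ) : ℂ := ((b n).normed volume y : ℝ)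
  have hφ (n : ℕ) : ContDiff ℝ (⊤ : ℕ∞) (φ n) :=
    Complex.ofRealCLM.contDiff.comp (b n).contDiff_normed
  have hφc (n : ℕ) : HasCompactSupport (φ n) :=
    (b n).hasCompactSupport_normed.comp_left (g := Complex.ofReal) Complex.ofReal_zero
  have hφΩ (n : ℕ) {s : ℝ} (hs : s ∈ Set.uIcc x x') : ∀ y ∈ tsupport (φ n), s - y ∈ Ω := by
    intro y hy
    have hy' : y ∈ Metric.closedBall 0 (b n).rOut := by
      rw [← (b n).tsupport_normed_eq (μ := volume)]
      exact tsupport_comp_subset Complex.ofReal_zero _ hy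
    refine hrΩ (Metric.closedBall_subset_cthickening hs r ?_)
    simpa using (mem_closedBall_zero_iff.1 hy').trans (hbr n)
  have hconst (n : ℕ) :
      U.U x (∫ y, φ n (x - y) • k y) = U.U x' (∫ y, φ n (x' - y) • k y) :=
    eq_of_convex_of_hasDerivAt_zero (convex_uIcc x x')
      (fun s hs => U.hasDerivAt_apply_integral_smul_sub hk hgen (hφ n) (hφc n) (hφΩ n hs))
      Set.left_mem_uIcc Set.right_mem_uIcc
  have hlim {z : ℝ} (hz : z ∈ Ω) :
      Tendsto (fun n => U.U z (∫ y, φ n (z - y) • k y)) atTop (𝓝 (U.U z (k z))) := by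
    simp only [φ, Complex.coe_smul]
    exact ((U.U z).continuous.tendsto _).comp (tendsto_integral_normed_smul
      hk.aestronglyMeasurable (hkc.continuousAt (Ω.isOpen.mem_nhds hz)) hb)
  exact tendsto_nhds_unique (hlim hx) ((hlim hx').congr fun n => (hconst n).symm)

end Integrate

end UnitaryGroup

section Kernel

variable {F : ℝ → ℂ} {Ω : Opens ℝ} (hF : IsPositiveDefiniteOn F Ω)

theorem dense_span_xi : Dense (Submodule.span ℂ (Set.range (xi hF)) : Set (HF hF)) := by
  rw [Submodule.dense_iff_topologicalClosure_eq_top, Submodule.topologicalClosure_eq_top_iff,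
    Submodule.eq_bot_iff]
  refine fun f hf => RKHS.ext (𝕜 := ℂ) fun x => ?_
  rw [← inner_xi, RKHS.coe_zero (𝕜 := ℂ), Pi.zero_apply]
  exact Submodule.inner_right_of_mem_orthogonal (Submodule.subset_span (Set.mem_range_self x)) hf

theorem norm_xi_le (y : Ω) : ‖xi hF y‖ ≤ √‖F 0‖ := by
  apply Real.le_sqrt_of_sq_le
  rw [← inner_self_eq_norm_sq (𝕜 := ℂ), inner_xi_xi, sub_self]
  exact Complex.re_le_norm _

/-- The family `y ↦ F (· - y)` of kernel functions, extended by zero to `y ∉ Ω` so that integrals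
over `Ω` become integrals over `ℝ`. -/
def xiExtend : ℝ → HF hF :=
  Function.extend Subtype.val (xi hF) 0

theorem xiExtend_coe (y : Ω) : xiExtend hF y = xi hF y :=
  Subtype.val_injective.extend_apply _ _ y

theorem xiExtend_of_notMem {y : ℝ} (hy : y ∉ Ω) : xiExtend hF y = 0 :=
  Function.extend_apply' _ _ _ fun ⟨z, hz⟩ => hy (hz ▸ z.2)

theorem norm_xiExtend_le (y : ℝ) : ‖xiExtend hF y‖ ≤ √‖F 0‖ := by
  by_cases hy : y ∈ Ω
  · exact xiExtend_coe hF ⟨y, hy⟩ ▸ norm_xi_le hF ⟨y, hy⟩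
  · simp [xiExtend_of_notMem hF hy]

theorem continuousOn_xiExtend (hc : ContinuousOn F ((Ω : Set ℝ) - (Ω : Set ℝ))) :
    ContinuousOn (xiExtend hF) Ω :=
  continuousOn_iff_continuous_domRestrict.2
    ((continuous_xi hF hc).congr fun y => (xiExtend_coe hF y).symm)

theorem locallyIntegrable_xiExtend (hc : ContinuousOn F ((Ω : Set ℝ) - (Ω : Set ℝ))) :
    LocallyIntegrable (xiExtend hF) := by
  have hmeas : StronglyMeasurable (xiExtend hF) :=
    (MeasurableEmbedding.subtype_coe Ω.isOpen.measurableSet).stronglyMeasurable_extend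
      (continuous_xi hF hc).stronglyMeasurable stronglyMeasurable_zero
  exact (memLp_top_of_bound hmeas.aestronglyMeasurable _
    (.of_forall (norm_xiExtend_le hF))).locallyIntegrable le_top

theorem Fphi_eq_integral (φ : ℝ → ℂ) : Fphi hF φ = ∫ y, φ y • xiExtend hF y := by
  simp only [Fphi, ← xiExtend_coe]
  refine (integral_subtype_comap Ω.isOpen.measurableSet fun y => φ y • xiExtend hF y).trans ?_
  exact setIntegral_eq_integral_of_forall_compl_eq_zero fun y hy => by
    rw [xiExtend_of_notMem hF hy, smul_zero]

theorem apply_Fphi {E : Type*} [NormedAddCommGroup E] [InnerProductSpace ℂ E] [CompleteSpace E]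
    (W : HF hF →ₗᵢ[ℂ] E) (φ : ℝ → ℂ) : W (Fphi hF φ) = ∫ y, φ y • W (xiExtend hF y) := by
  simp only [Fphi_eq_integral, ← map_smul]
  exact (W.integral_comp_comm _).symm

end Kernel

section Orbit

variable {F : ℝ → ℂ} {Ω : Opens ℝ} {hF : IsPositiveDefiniteOn F Ω} {E : Type*}
  [NormedAddCommGroup E] [InnerProductSpace ℂ E] [CompleteSpace E] {W : HF hF →ₗᵢ[ℂ] E}
  {U : UnitaryGroup E}

theorem hasGeneratorAt_apply_Fphi_of_apply_xi_eq {κ : E}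
    (hκ : ∀ x : Ω, W (xi hF x) = U.U (-x) κ) (φ : 𝓓(Ω, ℂ)) :
    U.HasGeneratorAt (W (Fphi hF φ)) (W (Fphi hF (deriv φ))) := by
  have hsmear {ψ : ℝ → ℂ} (hψ : tsupport ψ ⊆ Ω) :
      W (Fphi hF ψ) = ∫ y, ψ y • U.U (-y) κ := by
    rw [apply_Fphi]
    congr 1 with y
    by_cases hy : y ∈ Ω
    · rw [xiExtend_coe hF ⟨y, hy⟩, hκ]
    · rw [image_eq_zero_of_notMem_tsupport fun h => hy (hψ h), zero_smul, zero_smul]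
  rw [hsmear φ.tsupport_subset, hsmear (tsupport_deriv_subset.trans φ.tsupport_subset)]
  exact U.hasGeneratorAt_integral_smul_orbit (φ.contDiff.of_le (by simp)) φ.hasCompactSupport κ

theorem exists_apply_xi_eq_of_hasGeneratorAt (hΩ : IsConnected (Ω : Set ℝ))
    (hc : ContinuousOn F ((Ω : Set ℝ) - (Ω : Set ℝ)))
    (hgen : ∀ φ : 𝓓(Ω, ℂ), U.HasGeneratorAt (W (Fphi hF φ)) (W (Fphi hF (deriv φ)))) :
    ∃ κ : E, ∀ x : Ω, W (xi hF x) = U.U (-x) κ := by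
  obtain ⟨x₀, hx₀⟩ := hΩ.nonempty
  have hloc : LocallyIntegrable fun y => W (xiExtend hF y) := fun y =>
    (locallyIntegrable_xiExtend hF hc y).imp fun _ hs =>
      ⟨hs.1, W.toContinuousLinearMap.integrable_comp hs.2⟩
  refine ⟨U.U x₀ (W (xiExtend hF x₀)), fun x => ?_⟩
  have hconst := U.apply_eq_apply_of_hasGeneratorAt hloc (by simpa only [apply_Fphi] using hgen)
    hΩ.isPreconnected (W.continuous.comp_continuousOn (continuousOn_xiExtend hF hc)) hx₀ x.2
  rw [hconst, ← U.add, neg_add_cancel, U.zero, xiExtend_coe]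

end Orbit

section GNS

instance {𝕜 E : Type*} [RCLike 𝕜] [NormedAddCommGroup E] [InnerProductSpace 𝕜 E] :
    InnerProductSpace 𝕜 (ULift.{u} E) where
  inner x y := inner 𝕜 x.down y.down
  norm_sq_eq_re_inner x := norm_sq_eq_re_inner x.down
  conj_inner_symm x y := inner_conj_symm x.down y.down
  add_left x y z := inner_add_left x.down y.down z.down
  smul_left x y r := inner_smul_left x.down y.down r

variable {F : ℝ → ℂ}

theorem IsPositiveDefiniteOn.exists_unitaryGroup_inner_eq (hF : IsPositiveDefiniteOn F Set.univ)
    (hc : Continuous F) :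
    ∃ (𝒦 : Type u) (_ : NormedAddCommGroup 𝒦) (_ : InnerProductSpace ℂ 𝒦) (_ : CompleteSpace 𝒦)
      (U : UnitaryGroup 𝒦) (κ : 𝒦), ∀ t, inner ℂ κ (U.U t κ) = F t := by
  have hF' : IsPositiveDefiniteOn F (⊤ : Opens ℝ) := hF
  let ξ (x : ℝ) : HF hF' := xi hF' ⟨x, trivial⟩
  have hξ : Continuous ξ := (continuous_xi hF' hc.continuousOn).comp (by fun_prop)
  have hdense : Dense (Submodule.span ℂ (Set.range ξ) : Set (HF hF')) := by
    have hrange : Set.range ξ = Set.range (xi hF') :=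
      (Homeomorph.Set.univ ℝ).symm.surjective.range_comp (xi hF')
    rw [hrange]
    exact dense_span_xi hF'
  have hinner (x y : ℝ) : inner ℂ (ξ x) (ξ y) = F (x - y) := inner_xi_xi hF' _ _
  obtain ⟨U, hU⟩ := exists_unitaryGroup_of_translation_invariant hξ hdense
    fun t x y => by simp only [hinner, sub_sub_sub_cancel_right]
  let e : HF hF' ≃ₗᵢ[ℂ] ULift.{u} (HF hF') := (LinearIsometryEquiv.ulift ℂ (HF hF')).symm
  refine ⟨ULift.{u} (HF hF'), inferInstance, inferInstance, inferInstance, U.map e, e (ξ 0),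
    fun t => ?_⟩
  rw [U.map_apply, e.inner_map_map, hU, hinner, sub_sub_cancel]

theorem exists_extension_iff_exists_apply_xi_eq {Ω : Opens ℝ} (hF : IsPositiveDefiniteOn F Ω) :
    (∃ F' : ℝ → ℂ, Continuous F' ∧ IsPositiveDefiniteOn F' Set.univ ∧
      ∀ x ∈ (Ω : Set ℝ) - (Ω : Set ℝ), F' x = F x) ↔
    ∃ (𝒦 : Type u) (_ : NormedAddCommGroup 𝒦) (_ : InnerProductSpace ℂ 𝒦) (_ : CompleteSpace 𝒦)
      (W : HF hF →ₗᵢ[ℂ] 𝒦) (U : UnitaryGroup 𝒦) (κ : 𝒦), ∀ x : Ω, W (xi hF x) = U.U (-x) κ := by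
  constructor
  · rintro ⟨F', hc', hF', hext⟩
    obtain ⟨𝒦, _, _, _, U, κ, hκ⟩ := hF'.exists_unitaryGroup_inner_eq hc'
    obtain ⟨W, hW⟩ := exists_linearIsometry_of_inner_eq (dense_span_xi hF)
      (g := fun x : Ω => U.U (-x) κ) fun x y => by
        rw [U.inner_apply_neg_apply_neg, hκ, inner_xi_xi, hext _ (Set.sub_mem_sub x.2 y.2)]
    exact ⟨𝒦, _, _, inferInstance, W, U, κ, hW⟩
  · rintro ⟨𝒦, _, _, _, W, U, κ, hκ⟩
    refine ⟨fun t => inner ℂ κ (U.U t κ), continuous_const.inner (U.continuous κ),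
      isPositiveDefiniteOn_of_inner_eq (ξ := fun x => U.U (-x) κ)
        fun x _ y _ => U.inner_apply_neg_apply_neg x y κ κ, ?_⟩
    rintro _ ⟨x, hx, y, hy, rfl⟩
    rw [← inner_xi_xi hF ⟨x, hx⟩ ⟨y, hy⟩, ← W.inner_map_map, hκ, hκ, U.inner_apply_neg_apply_neg]

end GNS

end PDExt

end

theorem mainTheorem1 (Ω : Opens ℝ) (hΩ : IsConnected (Ω : Set ℝ)) (F : ℝ → ℂ)
    (hc : ContinuousOn F ((Ω : Set ℝ) - (Ω : Set ℝ)))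
    (hF : PDExt.IsPositiveDefiniteOn F (Ω : Set ℝ)) :
    (∃ F' : ℝ → ℂ, Continuous F' ∧ PDExt.IsPositiveDefiniteOn F' Set.univ ∧
      ∀ x ∈ (Ω : Set ℝ) - (Ω : Set ℝ), F' x = F x) ↔
    ∃ (𝒦 : Type u) (_ : NormedAddCommGroup 𝒦) (_ : InnerProductSpace ℂ 𝒦) (_ : CompleteSpace 𝒦)
      (W : PDExt.HF hF →ₗᵢ[ℂ] 𝒦) (U : PDExt.UnitaryGroup 𝒦),
      ∀ φ : 𝓓(Ω, ℂ), ∃ h : W (PDExt.Fphi hF φ) ∈ U.generator.domain,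
        U.generator ⟨W (PDExt.Fphi hF φ), h⟩ = W (PDExt.Fphi hF (deriv φ)) := by
  rw [PDExt.exists_extension_iff_exists_apply_xi_eq hF]
  simp only [PDExt.UnitaryGroup.exists_generator_apply_eq_iff]
  constructor
  · rintro ⟨𝒦, _, _, _, W, U, κ, hκ⟩
    exact ⟨𝒦, _, _, inferInstance, W, U, PDExt.hasGeneratorAt_apply_Fphi_of_apply_xi_eq hκ⟩
  · rintro ⟨𝒦, _, _, _, W, U, hgen⟩
    exact ⟨𝒦, _, _, inferInstance, W, U, PDExt.exists_apply_xi_eq_of_hasGeneratorAt hΩ hc hgen⟩
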